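/- Let $r\ge 1$, $n=r+1$, let $\alpha,\beta\in\mathbb C$, $\mathbf c=(c_1,\dots,c_r)$, $\mathbf d=(d_1,\dots,d_r)\in\mathbb C^r$, and let $$A=\begin{bmatrix}\alpha I_r & \mathbf c\\ \mathbf d^T & \beta\end{bmatrix}\in M_n(\mathbb C)$$ be the arrowhead matrix with last column $(c_1,\dots,c_r,\beta)^T$ and last row $(d_1,\dots,d_r,\beta)$. Let $J=I_{n-1}\oplus(-1)$, $[x,y]_J=y^*Jx$, and let $$W^J(A)=\{[Ax,x]_J:\ x\in\mathbb C^n,\ [x,x]_J=1\}\ \cup\ \{-[Ax,x]_J:\ x\in\mathbb C^n,\ [x,x]_J=-1\}$$ be the Krein space numerical range of $A$. For $f_1,f_2\in\mathbb C$ and $M>0$, the non-degenerate hyperbolic disc with foci $f_1,f_2$ and non-transverse axis of length $M$ is the closed set $\{z\in\mathbb C:\ \big||z-f_1|-|z-f_2|\big|\ge N\}$, where $N>0$ (the length of the transverse axis) satisfies $N^2+M^2=|f_1-f_2|^2$; it consists of the two convex regions bounded by the branches of the hyperbola with these foci and axes. Write $\|\cdot\|$ for the Euclidean norm and $\mathbf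 c^T\mathbf d=\sum_i c_id_i$. Then $W^J(A)$ is a non-degenerate hyperbolic disc (for some foci and some length of the non-transverse axis) if and only if $$\Big||\alpha-\beta|^2-2\|\mathbf c\|^2-2\|\mathbf d\|^2\Big|<\Big|(\alpha-\beta)^2+4\,\mathbf c^T\mathbf d\Big| .\qquad(*)$$ Moreover, $(*)$ holds if and only if $W^J(A)$ is the non-degenerate hyperbolic disc with foci $$\tfrac12(\alpha+\beta)\pm\tfrac12\sqrt{(\alpha-\beta)^2+4\,\mathbf c^T\mathbf d}$$ (for either choice of the complex square root) and non-transverse axis of length $$\Big(\tfrac12\big|(\alpha-\beta)^2+4\,\mathbf c^T\mathbf d\big|-\tfrac12|\alpha-\beta|^2+\|\mathbf c\|^2+\|\mathbf d\|^2\Big)^{1/2}.$$ -/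

import Mathlib

noncomputable section

namespace KreinRange

open Matrix

/-- The indefinite form `[x, y]_H = y* H x` on `ℂ^ι`. -/
def form {ι : Type*} [Fintype ι] (H : Matrix ι ι ℂ) (x y : ι → ℂ) : ℂ :=
  star y ⬝ᵥ (H *ᵥ x)

/-- `W^H_+(A) = {[Ax, x]_H : [x, x]_H = 1}`. -/
def rangePos {ι : Type*} [Fintype ι] (H A : Matrix ι ι ℂ) : Set ℂ :=
  {w | ∃ x : ι → ℂ, form H x x = 1 ∧ w = form H (A *ᵥ x) x}

/-- `W^H_-(A) = {[Ax, x]_H : [x, x]_H = -1}`. -/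
def rangeNeg {ι : Type*} [Fintype ι] (H A : Matrix ι ι ℂ) : Set ℂ :=
  {w | ∃ x : ι → ℂ, form H x x = -1 ∧ w = form H (A *ᵥ x) x}

/-- The Krein space (indefinite) numerical range `W^H(A) = -W^H_-(A) ∪ W^H_+(A)`. -/
def numericalRange {ι : Type*} [Fintype ι] (H A : Matrix ι ι ℂ) : Set ℂ :=
  {w | -w ∈ rangeNeg H A} ∪ rangePos H A

/-- The inertia matrix `J = I_r ⊕ (-I_s)`. -/
def inertia (r s : ℕ) : Matrix (Fin r ⊕ Fin s) (Fin r ⊕ Fin s) ℂ :=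
  fromBlocks 1 0 0 (-1)

/-- The arrowhead matrix of order `r + 1` with diagonal `(α, …, α, β)`, whose last column starts
with the entries of `c` and whose last row starts with the entries of `d`. -/
def arrowhead {r : ℕ} (α β : ℂ) (c d : Fin r → ℂ) :
    Matrix (Fin r ⊕ Fin 1) (Fin r ⊕ Fin 1) ℂ :=
  fromBlocks (α • 1) (of fun i _ => c i) (of fun _ j => d j) (β • 1)


/-- The closed region bounded by the hyperbola with foci `f₁`, `f₂` and transverse axis of length `N`
(the points whose distances to the foci differ by exactly `N`): the two convex pieces bounded by its two branches,
each containing a focus. -/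
def hyperbolicRegion (f₁ f₂ : ℂ) (N : ℝ) : Set ℂ :=
  {z | N ≤ |‖z - f₁‖ - ‖z - f₂‖|}

/-- `S` is the non-degenerate hyperbolic disc with foci `f₁`, `f₂` and non-transverse axis of
(full) length `M`. The transverse axis has length `N > 0`, the non-transverse one has length `M > 0`,
and the distance between the foci satisfies `|f₁ - f₂|² = N² + M²`. -/
def IsHyperbolicDisc (S : Set ℂ) (f₁ f₂ : ℂ) (M : ℝ) : Prop :=
  ∃ N : ℝ, 0 < N ∧ 0 < M ∧ N ^ 2 + M ^ 2 = ‖f₁ - f₂‖ ^ 2 ∧ S = hyperbolicRegion f₁ f₂ N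

end KreinRange

end

/-!
Write `D = |α - β|² - 2‖c‖² - 2‖d‖²` and `S = (α - β)² + 4 cᵀd`. Splitting a vector as `(u, v)` and
passing to `C = ±(‖u‖² + ‖v‖²)`, `g = ±2 conj v • u`, the quadratic map defining the range becomes
linear: translated by its centre `(α + β) / 2`, the range is the image of the whole two-sheeted
hyperboloid `C² - ‖g‖² = 1` in the Lorentz space `ℝ × ℂ^r` under a real-linear map to the plane
(`mem_numericalRange_iff`). A direction `e` in the plane pulls back to a covector whose Lorentz square
is `(D |e|² + Re (conj e² S)) / 8` (`lorentz_coef`), and this quadratic form in `e` is indefinite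
exactly when `|D| < |S|`.

If it is indefinite, a square root `s` of `S` and `I * s` are orthogonal directions, one timelike and
one spacelike. Since the Lorentz space has dimension at least three, the joint values of the two
covectors on the hyperboloid fill a hyperbolic region (`exists_unit_lorentz_eq_eq_iff`), whose
equation is that of the claimed disc (`mem_hyperbolicRegion_iff`).

Conversely, let the range be a hyperbolic disc with foci `f₁`, `f₂`. Its projection onto the line
through the foci misses an interval and is not a single point, whereas a nonzero covector which is not
timelike takes all nonzero values on the hyperboloid (`exists_unit_lorentz_eq`), so the form is
positive at `f₁ - f₂`. Its projection onto the perpendicular line is onto, whereas a nonzero covector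
with nonnegative square has no zero on the hyperboloid (`eq_zero_of_lorentz_orthogonal`), so the form
is negative at `I * (f₁ - f₂)`. Hence it is indefinite.
-/

namespace KreinRange

open Matrix ComplexConjugate

/-! ### Two-sheeted hyperboloids in Lorentz space -/

section Lorentz

variable {V : Type*} [NormedAddCommGroup V] [InnerProductSpace ℝ V]

/-- Reverse Cauchy–Schwarz: on `ℝ × V`, a covector `(a, b)` with nonnegative Lorentz square that
vanishes at a unit timelike vector `(C, g)` is zero. -/
theorem eq_zero_of_lorentz_orthogonal {a C : ℝ} {b g : V} (hab : ‖b‖ ^ 2 ≤ a ^ 2)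
    (hC : C ^ 2 - ‖g‖ ^ 2 = 1) (h : a * C + inner ℝ b g = 0) : a = 0 ∧ b = 0 := by
  have h1 := abs_real_inner_le_norm b g
  have h2 : (a * C) ^ 2 ≤ (‖b‖ * ‖g‖) ^ 2 := by
    rw [show a * C = -inner ℝ b g by linarith, neg_sq]
    exact sq_le_sq' (by linarith [neg_abs_le (inner ℝ b g : ℝ)]) ((le_abs_self _).trans h1)
  have h3 : ‖b‖ ^ 2 * ‖g‖ ^ 2 ≤ a ^ 2 * ‖g‖ ^ 2 := by gcongr
  have ha : a ^ 2 = 0 := le_antisymm (by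
    have : a ^ 2 * (C ^ 2 - ‖g‖ ^ 2) = a ^ 2 := by rw [hC, mul_one]
    nlinarith) (sq_nonneg a)
  refine ⟨by simpa using ha, ?_⟩
  have hb : ‖b‖ ^ 2 = 0 := le_antisymm (by linarith) (sq_nonneg _)
  simpa using hb

/-- The kernel of a timelike covector is negative definite. -/
theorem lorentz_nonpos_of_orthogonal {a k : ℝ} {b κ : V} (hab : ‖b‖ ^ 2 < a ^ 2)
    (h : a * k + inner ℝ b κ = 0) : k ^ 2 ≤ ‖κ‖ ^ 2 ∧ (k ^ 2 = ‖κ‖ ^ 2 → k = 0 ∧ κ = 0) := by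
  have h1 := abs_real_inner_le_norm b κ
  have h2 : (a * k) ^ 2 ≤ (‖b‖ * ‖κ‖) ^ 2 := by
    rw [show a * k = -inner ℝ b κ by linarith, neg_sq]
    exact sq_le_sq' (by linarith [neg_abs_le (inner ℝ b κ : ℝ)]) ((le_abs_self _).trans h1)
  have ha : 0 < a ^ 2 := lt_of_le_of_lt (sq_nonneg _) hab
  have h3 : ‖b‖ ^ 2 * ‖κ‖ ^ 2 ≤ a ^ 2 * ‖κ‖ ^ 2 := by gcongr
  have h4 : k ^ 2 ≤ ‖κ‖ ^ 2 := by
    have : a ^ 2 * k ^ 2 ≤ a ^ 2 * ‖κ‖ ^ 2 := by nlinarith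
    exact le_of_mul_le_mul_left this ha
  refine ⟨h4, fun he => ?_⟩
  have h5 : ‖κ‖ ^ 2 = 0 := by
    by_contra hne
    have : 0 < ‖κ‖ ^ 2 := lt_of_le_of_ne (sq_nonneg _) (Ne.symm hne)
    have := mul_lt_mul_of_pos_right hab this
    rw [← he] at this h3
    nlinarith
  rw [h5] at he
  exact ⟨by simpa using he, by simpa using h5⟩

/-- A covector that is not timelike takes every nonzero value on the two-sheeted unit hyperboloid. Its
space component `b` vanishes only if it is zero. -/
theorem exists_unit_lorentz_eq {a : ℝ} {b : V} (hab : a ^ 2 ≤ ‖b‖ ^ 2) (hb : b ≠ 0) {x : ℝ}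
    (hx : x ≠ 0) : ∃ (C : ℝ) (g : V), C ^ 2 - ‖g‖ ^ 2 = 1 ∧ a * C + inner ℝ b g = x := by
  have hB : 0 < ‖b‖ := norm_pos_iff.2 hb
  -- In the plane spanned by the time axis and `b`, the hyperbola is parametrized by
  -- `τ ↦ ((τ + τ⁻¹) / 2, (τ - τ⁻¹) / 2)`, which makes the equation quadratic in `τ`.
  obtain ⟨τ, hτ, hq⟩ : ∃ τ : ℝ, τ ≠ 0 ∧ (a + ‖b‖) * τ ^ 2 - 2 * x * τ + (a - ‖b‖) = 0 := by
    by_cases h0 : a + ‖b‖ = 0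
    · refine ⟨-‖b‖ / x, div_ne_zero (neg_ne_zero.2 hB.ne') hx, ?_⟩
      rw [h0, eq_neg_of_add_eq_zero_left h0]
      field_simp
      ring
    · have hd : 0 ≤ x ^ 2 + ‖b‖ ^ 2 - a ^ 2 := by nlinarith [sq_nonneg x]
      have hr := Real.sq_sqrt hd
      have hr0 := Real.sqrt_nonneg (x ^ 2 + ‖b‖ ^ 2 - a ^ 2)
      set R := √(x ^ 2 + ‖b‖ ^ 2 - a ^ 2)
      have key : ∀ S : ℝ, S ^ 2 = x ^ 2 + ‖b‖ ^ 2 - a ^ 2 →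
          (a + ‖b‖) * ((x + S) / (a + ‖b‖)) ^ 2 - 2 * x * ((x + S) / (a + ‖b‖))
            + (a - ‖b‖) = 0 := by
        intro S hS
        field_simp
        nlinarith
      rcases lt_or_gt_of_ne hx with h | h
      · exact ⟨(x + -R) / (a + ‖b‖), div_ne_zero (by linarith) h0, key _ (by simpa using hr)⟩
      · exact ⟨(x + R) / (a + ‖b‖), div_ne_zero (by linarith) h0, key _ hr⟩
  refine ⟨(τ + τ⁻¹) / 2, ((τ - τ⁻¹) / 2 * ‖b‖⁻¹) • b, ?_, ?_⟩
  · rw [norm_smul, Real.norm_eq_abs, mul_pow, sq_abs]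
    field_simp
    ring
  · rw [inner_smul_right, real_inner_self_eq_norm_sq]
    field_simp
    linarith

/-- The joint values of a timelike and a spacelike covector, orthogonal to each other, on the
two-sheeted unit hyperboloid fill the region `X² / P - Y² / Q ≥ 1`. The dimension hypothesis supplies
a spacelike vector in their common kernel; without it only the boundary would be attained. -/
theorem exists_unit_lorentz_eq_eq_iff [FiniteDimensional ℝ V] (hV : 2 ≤ Module.finrank ℝ V)
    {a₁ a₂ P Q : ℝ} {b₁ b₂ : V} (hP : 0 < P) (hQ : 0 < Q) (h₁ : a₁ ^ 2 - ‖b₁‖ ^ 2 = P)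
    (h₂ : a₂ ^ 2 - ‖b₂‖ ^ 2 = -Q) (h₁₂ : a₁ * a₂ - inner ℝ b₁ b₂ = 0) (X Y : ℝ) :
    (∃ (C : ℝ) (g : V), C ^ 2 - ‖g‖ ^ 2 = 1 ∧ a₁ * C + inner ℝ b₁ g = X ∧
      a₂ * C + inner ℝ b₂ g = Y) ↔ P * Q ≤ Q * X ^ 2 - P * Y ^ 2 := by
  have i₁ := real_inner_self_eq_norm_sq b₁
  have i₂ := real_inner_self_eq_norm_sq b₂
  have i₁₂ := real_inner_comm b₁ b₂
  have hne : X ^ 2 / P - Y ^ 2 / Q = (Q * X ^ 2 - P * Y ^ 2) / (P * Q) := by field_simp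
  have hiff : P * Q ≤ Q * X ^ 2 - P * Y ^ 2 ↔ 1 ≤ X ^ 2 / P - Y ^ 2 / Q := by
    rw [hne, one_le_div (by positivity)]
  rw [hiff]
  -- A vector with the prescribed values is a combination of the metric duals `(aᵢ, -bᵢ)` of the two
  -- covectors plus a vector `(k, κ)` in their common kernel.
  have hdec : ∀ (k : ℝ) (κ : V), a₁ * k + inner ℝ b₁ κ = 0 → a₂ * k + inner ℝ b₂ κ = 0 →
      (X / P * a₁ - Y / Q * a₂ + k) ^ 2 - ‖-(X / P) • b₁ + (Y / Q) • b₂ + κ‖ ^ 2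
        = X ^ 2 / P - Y ^ 2 / Q + (k ^ 2 - ‖κ‖ ^ 2) := by
    intro k κ e₁ e₂
    have e : ‖-(X / P) • b₁ + (Y / Q) • b₂ + κ‖ ^ 2
        = (X / P) ^ 2 * ‖b₁‖ ^ 2 + (Y / Q) ^ 2 * ‖b₂‖ ^ 2 + ‖κ‖ ^ 2
          - 2 * (X / P) * (Y / Q) * inner ℝ b₁ b₂ - 2 * (X / P) * inner ℝ b₁ κ
          + 2 * (Y / Q) * inner ℝ b₂ κ := by
      simp only [← real_inner_self_eq_norm_sq, inner_add_left, inner_add_right,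
        real_inner_smul_left, real_inner_smul_right]
      rw [real_inner_comm b₁ b₂, real_inner_comm b₁ κ, real_inner_comm b₂ κ]
      ring
    have p₁ : X ^ 2 / P = (X / P) ^ 2 * P := by field_simp
    have p₂ : Y ^ 2 / Q = (Y / Q) ^ 2 * Q := by field_simp
    rw [e, p₁, p₂]
    linear_combination (X / P) ^ 2 * h₁ + (Y / Q) ^ 2 * h₂ - 2 * (X / P) * (Y / Q) * h₁₂
      + 2 * (X / P) * e₁ - 2 * (Y / Q) * e₂
  have v₁ : ∀ (k : ℝ) (κ : V), a₁ * (X / P * a₁ - Y / Q * a₂ + k)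
      + inner ℝ b₁ (-(X / P) • b₁ + (Y / Q) • b₂ + κ) = X + (a₁ * k + inner ℝ b₁ κ) := by
    intro k κ
    simp only [inner_add_right, real_inner_smul_right, i₁]
    have : X / P * P = X := by field_simp
    linear_combination (X / P) * h₁ - (Y / Q) * h₁₂ + this
  have v₂ : ∀ (k : ℝ) (κ : V), a₂ * (X / P * a₁ - Y / Q * a₂ + k)
      + inner ℝ b₂ (-(X / P) • b₁ + (Y / Q) • b₂ + κ) = Y + (a₂ * k + inner ℝ b₂ κ) := by
    intro k κ
    simp only [inner_add_right, real_inner_smul_right, i₂]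
    rw [i₁₂]
    have : Y / Q * Q = Y := by field_simp
    linear_combination (X / P) * h₁₂ - (Y / Q) * h₂ + this
  constructor
  · rintro ⟨C, g, hC, hX, hY⟩
    set k := C - (X / P * a₁ - Y / Q * a₂) with hk
    set κ := g - (-(X / P) • b₁ + (Y / Q) • b₂) with hκ
    have eC : X / P * a₁ - Y / Q * a₂ + k = C := by rw [hk]; ring
    have eg : -(X / P) • b₁ + (Y / Q) • b₂ + κ = g := by rw [hκ]; abel
    have w₁ := v₁ k κ
    have w₂ := v₂ k κ
    rw [eC, eg] at w₁ w₂
    have e₁ : a₁ * k + inner ℝ b₁ κ = 0 := by linarith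
    have e₂ : a₂ * k + inner ℝ b₂ κ = 0 := by linarith
    have := hdec k κ e₁ e₂
    rw [eC, eg, hC] at this
    have := (lorentz_nonpos_of_orthogonal (by linarith) e₁).1
    linarith
  · intro hXY
    -- The common kernel of the two covectors is nonzero since `ℝ × V` has dimension at least three.
    let L : ℝ × V →ₗ[ℝ] ℝ × ℝ :=
      { toFun := fun h => (a₁ * h.1 + inner ℝ b₁ h.2, a₂ * h.1 + inner ℝ b₂ h.2)
        map_add' := fun h h' => by
          simp only [Prod.fst_add, Prod.snd_add, inner_add_right, Prod.mk_add_mk]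
          ext <;> simp <;> ring
        map_smul' := fun t h => by
          simp only [Prod.smul_fst, Prod.smul_snd, real_inner_smul_right, smul_eq_mul,
            RingHom.id_apply, Prod.smul_mk]
          ext <;> simp <;> ring }
    obtain ⟨⟨k, κ⟩, hL, hkne⟩ := (Submodule.ne_bot_iff _).1 (LinearMap.ker_ne_bot_of_finrank_lt
      (f := L) (by simp only [Module.finrank_prod, Module.finrank_self]; omega))
    have hL' : (a₁ * k + inner ℝ b₁ κ, a₂ * k + inner ℝ b₂ κ) = ((0 : ℝ), (0 : ℝ)) := hL
    obtain ⟨e₁, e₂⟩ := Prod.mk.inj hL'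
    obtain ⟨hle, heq⟩ := lorentz_nonpos_of_orthogonal (by linarith) e₁
    have hlt : 0 < ‖κ‖ ^ 2 - k ^ 2 := by
      refine sub_pos.2 (lt_of_le_of_ne hle fun h => hkne ?_)
      simpa using heq h
    -- This multiple of the kernel vector brings the Lorentz square down to one.
    set t := √((X ^ 2 / P - Y ^ 2 / Q - 1) / (‖κ‖ ^ 2 - k ^ 2)) with ht
    have ht2 : t ^ 2 * (‖κ‖ ^ 2 - k ^ 2) = X ^ 2 / P - Y ^ 2 / Q - 1 := by
      rw [ht, Real.sq_sqrt (div_nonneg (by linarith) hlt.le), div_mul_cancel₀ _ hlt.ne']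
    have f₁ : a₁ * (t * k) + inner ℝ b₁ (t • κ) = 0 := by
      rw [real_inner_smul_right]; linear_combination t * e₁
    have f₂ : a₂ * (t * k) + inner ℝ b₂ (t • κ) = 0 := by
      rw [real_inner_smul_right]; linear_combination t * e₂
    refine ⟨_, _, ?_, (v₁ (t * k) (t • κ)).trans (by rw [f₁, add_zero]),
      (v₂ (t * k) (t • κ)).trans (by rw [f₂, add_zero])⟩
    rw [hdec _ _ f₁ f₂, norm_smul, mul_pow, mul_pow, Real.norm_eq_abs, sq_abs]
    linarith

end Lorentz

/-! ### The equation of a hyperbolic disc -/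

/-- The Cartesian equation of a hyperbolic disc, in coordinates along and across the vector
`f₁ - f₂`, which is not normalized. -/
theorem mem_hyperbolicRegion_iff {f₁ f₂ : ℂ} {M N : ℝ} (hN : 0 < N) (hM : 0 < M)
    (h : N ^ 2 + M ^ 2 = ‖f₁ - f₂‖ ^ 2) (z : ℂ) :
    z ∈ hyperbolicRegion f₁ f₂ N ↔ N ^ 2 * M ^ 2 * ‖f₁ - f₂‖ ^ 2 ≤
      4 * M ^ 2 * (conj (f₁ - f₂) * (z - (f₁ + f₂) / 2)).re ^ 2
        - 4 * N ^ 2 * (conj (f₁ - f₂) * (z - (f₁ + f₂) / 2)).im ^ 2 := by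
  set w := z - (f₁ + f₂) / 2 with hw
  set f := f₁ - f₂ with hf
  set X := (conj f * w).re with hX
  set Y := (conj f * w).im with hY
  have z₁ : z - f₁ = w - f / 2 := by rw [hw, hf]; ring
  have z₂ : z - f₂ = w + f / 2 := by rw [hw, hf]; ring
  have hXY : ‖f‖ ^ 2 * ‖w‖ ^ 2 = X ^ 2 + Y ^ 2 := by
    rw [← mul_pow, ← Complex.norm_conj f, ← norm_mul, ← Complex.normSq_eq_norm_sq,
      Complex.normSq_apply, hX, hY]
    ring
  have n₁ : ‖z - f₁‖ ^ 2 = ‖w‖ ^ 2 + ‖f‖ ^ 2 / 4 - X := by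
    rw [z₁, hX]
    simp only [← Complex.normSq_eq_norm_sq, Complex.normSq_apply, Complex.sub_re, Complex.sub_im,
      Complex.div_ofNat_re, Complex.div_ofNat_im, Complex.mul_re, Complex.conj_re, Complex.conj_im]
    ring
  have n₂ : ‖z - f₂‖ ^ 2 = ‖w‖ ^ 2 + ‖f‖ ^ 2 / 4 + X := by
    rw [z₂, hX]
    simp only [← Complex.normSq_eq_norm_sq, Complex.normSq_apply, Complex.add_re, Complex.add_im,
      Complex.div_ofNat_re, Complex.div_ofNat_im, Complex.mul_re, Complex.conj_re, Complex.conj_im]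
    ring
  have hA := norm_nonneg (z - f₁)
  have hB := norm_nonneg (z - f₂)
  have hF : 0 < ‖f‖ ^ 2 := by rw [← h]; positivity
  have hM2 : 0 < M ^ 2 := by positivity
  have hN2 : 0 < N ^ 2 := by positivity
  change N ≤ |‖z - f₁‖ - ‖z - f₂‖| ↔ _
  generalize ‖z - f₁‖ = A at *
  generalize ‖z - f₂‖ = B at *
  generalize ‖f‖ ^ 2 = F at *
  generalize ‖w‖ ^ 2 = W at *
  -- Squaring twice removes the radicals.
  have key : F * ((A ^ 2 + B ^ 2 - N ^ 2) ^ 2 - (2 * (A * B)) ^ 2)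
      = F * (4 * X ^ 2) - 4 * N ^ 2 * (X ^ 2 + Y ^ 2) - F * N ^ 2 * M ^ 2 := by
    have : (2 * (A * B)) ^ 2 = 4 * (A ^ 2 * B ^ 2) := by ring
    rw [this, n₁, n₂]
    linear_combination (-4 * N ^ 2) * hXY + F * N ^ 2 * h
  have key' : F * ((A ^ 2 + B ^ 2 - N ^ 2) ^ 2 - (2 * (A * B)) ^ 2)
      = 4 * M ^ 2 * X ^ 2 - 4 * N ^ 2 * Y ^ 2 - N ^ 2 * M ^ 2 * F := by
    rw [key]; linear_combination (-4 * X ^ 2) * h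
  constructor
  · intro hz
    have hsq : N ^ 2 ≤ (A - B) ^ 2 := by
      rw [← sq_abs (A - B)]; exact pow_le_pow_left₀ hN.le hz 2
    have h1 : (2 * (A * B)) ^ 2 ≤ (A ^ 2 + B ^ 2 - N ^ 2) ^ 2 :=
      pow_le_pow_left₀ (by positivity) (by nlinarith) 2
    have := mul_nonneg hF.le (sub_nonneg.2 h1)
    linarith
  · intro hz
    have h1 : 0 ≤ (A ^ 2 + B ^ 2 - N ^ 2) ^ 2 - (2 * (A * B)) ^ 2 := by
      refine nonneg_of_mul_nonneg_right ?_ hF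
      linarith
    have h2 : N ^ 2 * F ≤ 4 * X ^ 2 := by
      have : M ^ 2 * (N ^ 2 * F) ≤ M ^ 2 * (4 * X ^ 2) := by
        nlinarith [mul_nonneg hN2.le (sq_nonneg Y)]
      exact le_of_mul_le_mul_left this hM2
    have h3 : 0 ≤ A ^ 2 + B ^ 2 - N ^ 2 := by
      have : N ^ 2 ≤ 4 * W := by
        have : F * N ^ 2 ≤ F * (4 * W) := by nlinarith [sq_nonneg Y]
        exact le_of_mul_le_mul_left this hF
      rw [n₁, n₂]; linarith
    have h4 : 2 * (A * B) ≤ A ^ 2 + B ^ 2 - N ^ 2 :=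
      (pow_le_pow_iff_left₀ (by positivity) h3 two_ne_zero).1 (by linarith)
    rw [← abs_of_pos hN, ← sq_le_sq]
    linarith

/-! ### The range as a linear image of a hyperboloid -/

variable {r : ℕ}

/-- The time component of the covector `h ↦ Re (conj e * offset h)` on the Lorentz space
`ℝ × EuclideanSpace ℂ (Fin r)`. The direction `e` need not be a unit. -/
noncomputable def timeCoef (α β e : ℂ) : ℝ := (conj e * ((α - β) / 2)).re

/-- The space component of the covector `h ↦ Re (conj e * offset h)`, represented through the real
inner product of `EuclideanSpace ℂ (Fin r)`. -/
noncomputable def spaceCoef (c d : Fin r → ℂ) (e : ℂ) : EuclideanSpace ℂ (Fin r) :=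
  (1 / 2 : ℂ) • (conj e • WithLp.toLp 2 c - e • WithLp.toLp 2 (star d))

/-- The real-linear map from `ℝ × EuclideanSpace ℂ (Fin r)` to `ℂ` which carries the two-sheeted unit
hyperboloid onto the numerical range translated by its centre `(α + β) / 2`. -/
noncomputable def offset (α β : ℂ) (c d : Fin r → ℂ) (C : ℝ) (g : EuclideanSpace ℂ (Fin r)) : ℂ :=
  C * ((α - β) / 2) + (star g.ofLp ⬝ᵥ c - d ⬝ᵥ g.ofLp) / 2

theorem re_conj_mul_offset (α β : ℂ) (c d : Fin r → ℂ) (C : ℝ) (g : EuclideanSpace ℂ (Fin r))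
    (e : ℂ) : (conj e * offset α β c d C g).re
      = timeCoef α β e * C + inner ℝ (spaceCoef c d e) g := by
  have h1 : (inner ℝ (spaceCoef c d e) g : ℝ) = (inner ℂ (spaceCoef c d e) g : ℂ).re := by
    simp [PiLp.inner_apply, Complex.inner]
  have h2 : (inner ℂ (WithLp.toLp 2 (star d)) g : ℂ) = d ⬝ᵥ g.ofLp := by
    simp [EuclideanSpace.inner_eq_star_dotProduct, dotProduct_comm]
  have h3 : (inner ℂ (WithLp.toLp 2 c) g : ℂ) = conj (star g.ofLp ⬝ᵥ c) := by
    rw [← inner_conj_symm]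
    simp [EuclideanSpace.inner_eq_star_dotProduct, dotProduct_comm]
  rw [h1, spaceCoef, inner_smul_left, inner_sub_left, inner_smul_left, inner_smul_left, h2, h3,
    offset, timeCoef]
  simp
  ring

theorem timeCoef_add (α β e e' : ℂ) :
    timeCoef α β (e + e') = timeCoef α β e + timeCoef α β e' := by
  simp [timeCoef]; ring

theorem spaceCoef_add (c d : Fin r → ℂ) (e e' : ℂ) :
    spaceCoef c d (e + e') = spaceCoef c d e + spaceCoef c d e' := by
  simp only [spaceCoef, map_add, add_smul, ← smul_add]
  congr 1
  abel

/-- The Lorentz form pulled back to the directions `e` in the plane. -/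
theorem lorentz_coef (α β : ℂ) (c d : Fin r → ℂ) (e : ℂ) :
    8 * (timeCoef α β e ^ 2 - ‖spaceCoef c d e‖ ^ 2) =
      (‖α - β‖ ^ 2 - 2 * ‖WithLp.toLp 2 c‖ ^ 2 - 2 * ‖WithLp.toLp 2 d‖ ^ 2) * ‖e‖ ^ 2
        + (conj e ^ 2 * ((α - β) ^ 2 + 4 * (c ⬝ᵥ d))).re := by
  have hd : ‖(WithLp.toLp 2 (star d) : EuclideanSpace ℂ (Fin r))‖ = ‖WithLp.toLp 2 d‖ := by
    simp [EuclideanSpace.norm_eq]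
  have hi : (inner ℂ (conj e • WithLp.toLp 2 c) (e • WithLp.toLp 2 (star d)) : ℂ)
      = conj (conj e ^ 2 * (c ⬝ᵥ d)) := by
    rw [inner_smul_left, inner_smul_right, EuclideanSpace.inner_eq_star_dotProduct]
    have : star d ⬝ᵥ star c = conj (c ⬝ᵥ d) := by
      rw [star_dotProduct_star]; rfl
    simp only [this, map_mul, map_pow, Complex.conj_conj]
    ring
  have hb : 4 * ‖spaceCoef c d e‖ ^ 2 = ‖e‖ ^ 2 * (‖WithLp.toLp 2 c‖ ^ 2 + ‖WithLp.toLp 2 d‖ ^ 2)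
      - 2 * (conj e ^ 2 * (c ⬝ᵥ d)).re := by
    rw [spaceCoef, norm_smul, mul_pow, @norm_sub_sq ℂ, hi, norm_smul, norm_smul, hd]
    simp only [RCLike.re_to_complex, Complex.conj_re, Complex.norm_conj]
    norm_num
    ring
  have ha : 8 * timeCoef α β e ^ 2 = ‖α - β‖ ^ 2 * ‖e‖ ^ 2
      + (conj e ^ 2 * (α - β) ^ 2).re := by
    rw [timeCoef, ← mul_div_assoc, Complex.div_ofNat_re]
    rw [← Complex.normSq_eq_norm_sq, ← Complex.normSq_eq_norm_sq, Complex.normSq_apply,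
      Complex.normSq_apply]
    simp only [Complex.mul_re, pow_two,
      Complex.mul_im, Complex.conj_re, Complex.conj_im]
    ring
  have hs : (conj e ^ 2 * ((α - β) ^ 2 + 4 * (c ⬝ᵥ d))).re
      = (conj e ^ 2 * (α - β) ^ 2).re + 4 * (conj e ^ 2 * (c ⬝ᵥ d)).re := by
    rw [mul_add, Complex.add_re, mul_left_comm]
    simp
  rw [hs]
  linear_combination ha - 2 * hb

theorem form_inertia_arrowhead (α β : ℂ) (c d u : Fin r → ℂ) (v : ℂ) :
    form (inertia r 1) (arrowhead α β c d *ᵥ Sum.elim u fun _ => v) (Sum.elim u fun _ => v)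
      = α * (‖WithLp.toLp 2 u‖ ^ 2 : ℝ) - β * (‖v‖ ^ 2 : ℝ) + v * (star u ⬝ᵥ c)
        - conj v * (d ⬝ᵥ u) := by
  have hu : ((‖WithLp.toLp 2 u‖ ^ 2 : ℝ) : ℂ) = star u ⬝ᵥ u := by
    rw [EuclideanSpace.norm_sq_eq, dotProduct]
    push_cast
    exact Finset.sum_congr rfl fun i _ => by simp [Complex.conj_mul']
  have hv : ((‖v‖ ^ 2 : ℝ) : ℂ) = conj v * v := by rw [Complex.conj_mul']; simp
  have h1 : ∑ i, α * (conj (u i) * u i) = ∑ i, conj (u i) * (α * u i) :=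
    Finset.sum_congr rfl fun i _ => by ring
  have h2 : ∑ i, v * (conj (u i) * c i) = ∑ i, conj (u i) * (c i * v) :=
    Finset.sum_congr rfl fun i _ => by ring
  rw [hu, hv, form, inertia, arrowhead, fromBlocks_mulVec, fromBlocks_mulVec]
  simp [dotProduct, mulVec, Fintype.sum_sum_type, Finset.mul_sum, mul_add, Finset.sum_add_distrib,
    Matrix.one_apply]
  rw [h1, h2]
  ring

theorem form_inertia (u : Fin r → ℂ) (v : ℂ) :
    form (inertia r 1) (Sum.elim u fun _ => v) (Sum.elim u fun _ => v)
      = ((‖WithLp.toLp 2 u‖ ^ 2 - ‖v‖ ^ 2 : ℝ) : ℂ) := by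
  have h := form_inertia_arrowhead 1 1 0 0 u v
  have h1 : arrowhead 1 1 (0 : Fin r → ℂ) 0 = 1 := by
    rw [← fromBlocks_one, arrowhead]
    congr 1 <;> exact one_smul _ _
  rw [h1, one_mulVec] at h
  rw [h]
  simp

theorem exists_sum_elim {p : (Fin r ⊕ Fin 1 → ℂ) → Prop} :
    (∃ x, p x) ↔ ∃ (u : Fin r → ℂ) (v : ℂ), p (Sum.elim u fun _ => v) := by
  refine ⟨fun ⟨x, hx⟩ => ⟨x ∘ Sum.inl, x (Sum.inr 0), ?_⟩, fun ⟨u, v, h⟩ => ⟨_, h⟩⟩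
  convert hx
  ext (i | i)
  · rfl
  · rw [Subsingleton.elim i 0]; rfl

theorem norm_toLp_smul_sq (t : ℂ) (u : Fin r → ℂ) :
    ‖(WithLp.toLp 2 (t • u) : EuclideanSpace ℂ (Fin r))‖ ^ 2
      = ‖t‖ ^ 2 * ‖WithLp.toLp 2 u‖ ^ 2 := by
  rw [WithLp.toLp_smul, norm_smul, mul_pow]

/-- A vector `(u, v)` with `‖u‖² - ‖v‖² = ±1` corresponds to the point
`±(‖u‖² + ‖v‖², 2 conj v • u)` of the two-sheeted unit hyperboloid: the two parts of the range come
from the two sheets. -/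
theorem mem_numericalRange_iff (hr : 1 ≤ r) (α β : ℂ) (c d : Fin r → ℂ) (w : ℂ) :
    w ∈ numericalRange (inertia r 1) (arrowhead α β c d) ↔
      ∃ (C : ℝ) (g : EuclideanSpace ℂ (Fin r)), C ^ 2 - ‖g‖ ^ 2 = 1 ∧
        w - (α + β) / 2 = offset α β c d C g := by
  have hmem : w ∈ numericalRange (inertia r 1) (arrowhead α β c d) ↔
      (∃ (u : Fin r → ℂ) (v : ℂ), ‖WithLp.toLp 2 u‖ ^ 2 - ‖v‖ ^ 2 = -1 ∧
        -w = α * (‖WithLp.toLp 2 u‖ ^ 2 : ℝ) - β * (‖v‖ ^ 2 : ℝ) + v * (star u ⬝ᵥ c)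
          - conj v * (d ⬝ᵥ u)) ∨
      (∃ (u : Fin r → ℂ) (v : ℂ), ‖WithLp.toLp 2 u‖ ^ 2 - ‖v‖ ^ 2 = 1 ∧
        w = α * (‖WithLp.toLp 2 u‖ ^ 2 : ℝ) - β * (‖v‖ ^ 2 : ℝ) + v * (star u ⬝ᵥ c)
          - conj v * (d ⬝ᵥ u)) := by
    have c1 : ∀ t : ℝ, (t : ℂ) = -1 ↔ t = -1 := fun t => by norm_cast
    have c2 : ∀ t : ℝ, (t : ℂ) = 1 ↔ t = 1 := fun t => by norm_cast
    simp only [numericalRange, rangeNeg, rangePos, Set.mem_union, Set.mem_ofPred_eq]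
    rw [exists_sum_elim, exists_sum_elim]
    simp only [form_inertia_arrowhead, form_inertia, c1, c2]
  rw [hmem]
  constructor
  · rintro (⟨u, v, h, hw⟩ | ⟨u, v, h, hw⟩)
    · refine ⟨-(‖WithLp.toLp 2 u‖ ^ 2 + ‖v‖ ^ 2), WithLp.toLp 2 ((-(2 * conj v)) • u), ?_, ?_⟩
      · rw [norm_toLp_smul_sq]
        simp only [norm_neg, norm_mul, Complex.norm_conj, Complex.norm_ofNat]
        linear_combination (‖WithLp.toLp 2 u‖ ^ 2 - ‖v‖ ^ 2 - 1) * h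
      · have h' : ((‖WithLp.toLp 2 u‖ ^ 2 : ℝ) : ℂ) - (‖v‖ ^ 2 : ℝ) = -1 := by
          rw [← Complex.ofReal_sub, h]; simp
        simp only [offset, star_smul, smul_dotProduct, dotProduct_smul, smul_eq_mul]
        simp only [star_neg, star_mul', Complex.star_def, Complex.conj_conj, map_ofNat]
        push_cast at *
        linear_combination -hw - (α + β) / 2 * h'
    · refine ⟨‖WithLp.toLp 2 u‖ ^ 2 + ‖v‖ ^ 2, WithLp.toLp 2 ((2 * conj v) • u), ?_, ?_⟩
      · rw [norm_toLp_smul_sq]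
        simp only [norm_mul, Complex.norm_conj, Complex.norm_ofNat]
        linear_combination (‖WithLp.toLp 2 u‖ ^ 2 - ‖v‖ ^ 2 + 1) * h
      · have h' : ((‖WithLp.toLp 2 u‖ ^ 2 : ℝ) : ℂ) - (‖v‖ ^ 2 : ℝ) = 1 := by
          rw [← Complex.ofReal_sub, h]; simp
        simp only [offset, star_smul, smul_dotProduct, dotProduct_smul, smul_eq_mul]
        simp only [star_mul', Complex.star_def, Complex.conj_conj, map_ofNat]
        push_cast at *
        linear_combination hw + (α + β) / 2 * h'
  · rintro ⟨C, g, hC, hw⟩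
    -- A unit vector `e` in the direction of `g`; it is arbitrary when `g = 0`.
    obtain ⟨e, he, hge⟩ : ∃ e : EuclideanSpace ℂ (Fin r), ‖e‖ = 1 ∧ g = (‖g‖ : ℂ) • e := by
      by_cases hg : g = 0
      · exact ⟨EuclideanSpace.single ⟨0, hr⟩ 1, by simp, by simp [hg]⟩
      · have : (‖g‖ : ℂ) ≠ 0 := by simpa using hg
        refine ⟨(‖g‖ : ℂ)⁻¹ • g, ?_, by rw [smul_smul, mul_inv_cancel₀ this, one_smul]⟩
        rw [norm_smul, norm_inv, Complex.norm_real, norm_norm,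
          inv_mul_cancel₀ (norm_ne_zero_iff.2 hg)]
    have hC1 : 1 ≤ |C| := by
      rw [← one_le_sq_iff_one_le_abs]; nlinarith [sq_nonneg ‖g‖]
    have hp : 0 ≤ (|C| + 1) / 2 := by linarith
    have hm : 0 ≤ (|C| - 1) / 2 := by linarith
    set p := √((|C| + 1) / 2) with hpdef
    set m := √((|C| - 1) / 2) with hmdef
    have p2 : p ^ 2 = (|C| + 1) / 2 := Real.sq_sqrt hp
    have m2 : m ^ 2 = (|C| - 1) / 2 := Real.sq_sqrt hm
    have hpm : ‖g‖ = 2 * (p * m) := by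
      refine (pow_left_inj₀ (norm_nonneg g) (by positivity) two_ne_zero).1 ?_
      have : (2 * (p * m)) ^ 2 = 4 * (p ^ 2 * m ^ 2) := by ring
      rw [this, p2, m2]
      linear_combination -hC - sq_abs C
    have hn : ∀ t : ℝ, ‖(WithLp.toLp 2 ((t : ℂ) • e.ofLp) : EuclideanSpace ℂ (Fin r))‖ ^ 2
        = t ^ 2 := fun t => by
      rw [norm_toLp_smul_sq, WithLp.toLp_ofLp, he, Complex.norm_real, Real.norm_eq_abs, sq_abs]
      ring
    have hn' : ∀ t : ℝ, ‖(t : ℂ)‖ ^ 2 = t ^ 2 := fun t => by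
      rw [Complex.norm_real, Real.norm_eq_abs, sq_abs]
    have hoff : offset α β c d C g = C * ((α - β) / 2)
        + p * m * (star e.ofLp ⬝ᵥ c - d ⬝ᵥ e.ofLp) := by
      rw [offset, hge, hpm]
      simp only [WithLp.ofLp_smul, star_smul, smul_dotProduct, dotProduct_smul, smul_eq_mul]
      simp only [Complex.star_def, Complex.conj_ofReal]
      push_cast
      ring
    rw [hoff] at hw
    rcases le_or_gt 0 C with h0 | h0
    · rw [abs_of_nonneg h0] at p2 m2
      refine Or.inr ⟨(p : ℂ) • e.ofLp, m, by rw [hn, hn', p2, m2]; ring, ?_⟩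
      rw [hn, hn', p2, m2]
      simp only [star_smul, smul_dotProduct, dotProduct_smul, smul_eq_mul]
      simp only [Complex.star_def, Complex.conj_ofReal]
      push_cast
      linear_combination hw
    · rw [abs_of_neg h0] at p2 m2
      refine Or.inl ⟨((-m : ℝ) : ℂ) • e.ofLp, p, by rw [hn, hn', neg_sq, p2, m2]; ring, ?_⟩
      rw [hn, hn', neg_sq, p2, m2]
      simp only [star_smul, smul_dotProduct, dotProduct_smul, smul_eq_mul]
      simp only [Complex.star_def, Complex.conj_ofReal]
      push_cast
      linear_combination -hw

/-! ### Hyperbolic discs and indefiniteness -/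

/-- Multiplying the direction by `I` turns the real coordinate into the imaginary one. -/
theorem re_conj_mul_I (f w : ℂ) : (conj (Complex.I * f) * w).re = (conj f * w).im := by
  simp [sub_eq_add_neg]

/-- Under the strict inequality, the direction of the segment joining the foci is timelike with value
`‖s‖² N² / 4` and the perpendicular direction is spacelike with value `-‖s‖² M² / 4`; they are
orthogonal, so the range is read off from `exists_unit_lorentz_eq_eq_iff`. -/
theorem isHyperbolicDisc_numericalRange (hr : 1 ≤ r) (α β : ℂ) (c d : Fin r → ℂ) (s : ℂ)
    (hs : s ^ 2 = (α - β) ^ 2 + 4 * (c ⬝ᵥ d))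
    (h : |‖α - β‖ ^ 2 - 2 * ‖WithLp.toLp 2 c‖ ^ 2 - 2 * ‖WithLp.toLp 2 d‖ ^ 2| <
      ‖(α - β) ^ 2 + 4 * (c ⬝ᵥ d)‖) :
    IsHyperbolicDisc (numericalRange (inertia r 1) (arrowhead α β c d))
        ((α + β) / 2 + s / 2) ((α + β) / 2 - s / 2)
        (√(‖(α - β) ^ 2 + 4 * (c ⬝ᵥ d)‖ / 2 - ‖α - β‖ ^ 2 / 2
          + ‖WithLp.toLp 2 c‖ ^ 2 + ‖WithLp.toLp 2 d‖ ^ 2)) := by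
  have hq := lorentz_coef α β c d
  rw [← hs, norm_pow] at h ⊢
  rw [← hs] at hq
  set D := ‖α - β‖ ^ 2 - 2 * ‖WithLp.toLp 2 c‖ ^ 2 - 2 * ‖WithLp.toLp 2 d‖ ^ 2 with hD
  obtain ⟨hl, hu⟩ := abs_lt.1 h
  have hM0 : ‖s‖ ^ 2 / 2 - ‖α - β‖ ^ 2 / 2 + ‖WithLp.toLp 2 c‖ ^ 2 + ‖WithLp.toLp 2 d‖ ^ 2
      = (‖s‖ ^ 2 - D) / 2 := by rw [hD]; ring
  rw [hM0]
  have hMp : 0 < (‖s‖ ^ 2 - D) / 2 := by linarith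
  have hNp : 0 < (‖s‖ ^ 2 + D) / 2 := by linarith
  have hN := Real.sqrt_pos.2 hNp
  have hM := Real.sqrt_pos.2 hMp
  have hN2 := Real.sq_sqrt hNp.le
  have hM2 := Real.sq_sqrt hMp.le
  set N := √((‖s‖ ^ 2 + D) / 2)
  set M := √((‖s‖ ^ 2 - D) / 2)
  have hf : (α + β) / 2 + s / 2 - ((α + β) / 2 - s / 2) = s := by ring
  have hc : ((α + β) / 2 + s / 2 + ((α + β) / 2 - s / 2)) / 2 = (α + β) / 2 := by ring
  have hNM : N ^ 2 + M ^ 2 = ‖(α + β) / 2 + s / 2 - ((α + β) / 2 - s / 2)‖ ^ 2 := by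
    rw [hf, hN2, hM2]; ring
  refine ⟨N, hN, hM, hNM, ?_⟩
  have hS : 0 < ‖s‖ ^ 2 := by linarith
  have hss : conj s ^ 2 * s ^ 2 = ((‖s‖ ^ 4 : ℝ) : ℂ) := by
    rw [← mul_pow, Complex.conj_mul']; push_cast; ring
  -- The directions `s` and `I * s` are orthogonal for the pulled-back Lorentz form.
  have q₁ : timeCoef α β s ^ 2 - ‖spaceCoef c d s‖ ^ 2 = ‖s‖ ^ 2 * N ^ 2 / 4 := by
    have := hq s
    rw [hss, Complex.ofReal_re] at this
    rw [hN2]; linear_combination this / 8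
  have q₂ : timeCoef α β (Complex.I * s) ^ 2 - ‖spaceCoef c d (Complex.I * s)‖ ^ 2
      = -(‖s‖ ^ 2 * M ^ 2 / 4) := by
    have := hq (Complex.I * s)
    rw [map_mul, mul_pow, Complex.conj_I, neg_sq, Complex.I_sq, mul_assoc, hss, norm_mul,
      Complex.norm_I, one_mul, neg_one_mul, Complex.neg_re, Complex.ofReal_re] at this
    rw [hM2]; linear_combination this / 8
  have q₁₂ : timeCoef α β s * timeCoef α β (Complex.I * s)
      - inner ℝ (spaceCoef c d s) (spaceCoef c d (Complex.I * s)) = 0 := by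
    have := hq (s + Complex.I * s)
    have e1 : s + Complex.I * s = (1 + Complex.I) * s := by ring
    have e2 : (conj (s + Complex.I * s) ^ 2 * s ^ 2).re = 0 := by
      rw [e1, map_mul, mul_pow, mul_assoc, hss, Complex.re_mul_ofReal]
      simp [pow_two]
    have e3 : ‖s + Complex.I * s‖ ^ 2 = 2 * ‖s‖ ^ 2 := by
      rw [e1, norm_mul, mul_pow, ← Complex.normSq_eq_norm_sq (1 + Complex.I), Complex.normSq_apply]
      norm_num
    rw [e2, e3, timeCoef_add, spaceCoef_add, norm_add_sq_real] at this
    rw [hN2] at q₁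
    rw [hM2] at q₂
    linear_combination this / 16 - q₁ / 2 - q₂ / 2
  have hdim : 2 ≤ Module.finrank ℝ (EuclideanSpace ℂ (Fin r)) := by
    rw [finrank_real_of_complex, finrank_euclideanSpace_fin]; omega
  ext w
  rw [mem_numericalRange_iff hr, mem_hyperbolicRegion_iff hN hM hNM, hf, hc]
  have key := exists_unit_lorentz_eq_eq_iff hdim (by positivity) (by positivity) q₁ q₂ q₁₂
    (conj s * (w - (α + β) / 2)).re (conj s * (w - (α + β) / 2)).im
  have hs0 : conj s ≠ 0 := by
    rw [Ne, map_eq_zero, ← norm_eq_zero]; rintro h0; simp [h0] at hS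
  have hmem : ∀ (C : ℝ) (g : EuclideanSpace ℂ (Fin r)),
      w - (α + β) / 2 = offset α β c d C g ↔
        timeCoef α β s * C + inner ℝ (spaceCoef c d s) g = (conj s * (w - (α + β) / 2)).re ∧
        timeCoef α β (Complex.I * s) * C + inner ℝ (spaceCoef c d (Complex.I * s)) g
          = (conj s * (w - (α + β) / 2)).im := by
    intro C g
    rw [← re_conj_mul_offset, ← re_conj_mul_offset, re_conj_mul_I, ← Complex.ext_iff,
      mul_right_inj' hs0, eq_comm]
  simp only [hmem]
  rw [key]
  set X := (conj s * (w - (α + β) / 2)).re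
  set Y := (conj s * (w - (α + β) / 2)).im
  constructor
  · intro h
    refine le_of_mul_le_mul_left ?_ hS
    linear_combination 16 * h
  · intro h
    linear_combination ‖s‖ ^ 2 / 16 * h

/-- The two axes of a hyperbolic disc are told apart by the projections of the disc onto them: one
projection misses an interval and the other is onto. This forces the pulled-back Lorentz form to be
positive in one direction and negative in the perpendicular one, hence indefinite. -/
theorem abs_lt_norm_of_isHyperbolicDisc (hr : 1 ≤ r) (α β : ℂ) (c d : Fin r → ℂ)
    {f₁ f₂ : ℂ} {M : ℝ}
    (h : IsHyperbolicDisc (numericalRange (inertia r 1) (arrowhead α β c d)) f₁ f₂ M) :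
    |‖α - β‖ ^ 2 - 2 * ‖WithLp.toLp 2 c‖ ^ 2 - 2 * ‖WithLp.toLp 2 d‖ ^ 2| <
      ‖(α - β) ^ 2 + 4 * (c ⬝ᵥ d)‖ := by
  obtain ⟨N, hN, hM, hNM, hW⟩ := h
  have hmem : ∀ z, (∃ (C : ℝ) (g : EuclideanSpace ℂ (Fin r)), C ^ 2 - ‖g‖ ^ 2 = 1 ∧
      z - (α + β) / 2 = offset α β c d C g) ↔ _ := fun z => by
    rw [← mem_numericalRange_iff hr, hW, mem_hyperbolicRegion_iff hN hM hNM]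
  have hq := lorentz_coef α β c d
  set f := f₁ - f₂ with hf
  set m := (f₁ + f₂) / 2 with hm
  set m' := (α + β) / 2 with hm'
  have hF : 0 < ‖f‖ ^ 2 := by rw [← hNM]; positivity
  have hf0 : conj f ≠ 0 := by
    rw [Ne, map_eq_zero, ← norm_eq_zero]; rintro h0; simp [h0] at hF
  have hsplit : ∀ z, conj f * (z - m') = conj f * (z - m) + conj f * (m - m') := fun z => by ring
  -- Every pair of coordinates is realised by a point of the plane.
  have hpt : ∀ X Y : ℝ, ∃ z, (conj f * (z - m)).re = X ∧ (conj f * (z - m)).im = Y := by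
    intro X Y
    refine ⟨m + (conj f)⁻¹ * (X + Y * Complex.I), ?_⟩
    rw [add_sub_cancel_left, mul_inv_cancel_left₀ hf0]
    simp
  -- In the direction of the transverse axis the disc omits a strip around its centre.
  have hpos : 0 < timeCoef α β f ^ 2 - ‖spaceCoef c d f‖ ^ 2 := by
    by_contra hle
    set κ := (conj f * (m - m')).re with hκ
    have hproj : ∀ {x : ℝ} {C : ℝ} {g : EuclideanSpace ℂ (Fin r)}, C ^ 2 - ‖g‖ ^ 2 = 1 →
        timeCoef α β f * C + inner ℝ (spaceCoef c d f) g = x →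
        N ^ 2 * ‖f‖ ^ 2 ≤ 4 * (x - κ) ^ 2 := by
      intro x C g hC hx
      have := (hmem (m' + offset α β c d C g)).1 ⟨C, g, hC, by ring⟩
      have hX : (conj f * (m' + offset α β c d C g - m)).re = x - κ := by
        rw [← hx, ← re_conj_mul_offset, hκ, ← Complex.sub_re]
        congr 1; ring
      rw [hX] at this
      have hM2 : 0 < M ^ 2 := by positivity
      refine le_of_mul_le_mul_left ?_ hM2
      nlinarith [mul_nonneg (sq_nonneg N)
        (sq_nonneg (conj f * (m' + offset α β c d C g - m)).im)]
    by_cases hb : spaceCoef c d f = 0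
    · have ha : timeCoef α β f = 0 := by
        rw [hb, norm_zero] at hle
        have := sq_nonneg (timeCoef α β f)
        simpa using (show timeCoef α β f ^ 2 = 0 by linarith)
      -- The projection is a single point, but a disc has points with opposite nonzero abscissae.
      have hsing : ∀ X : ℝ, N ^ 2 * ‖f‖ ^ 2 ≤ 4 * X ^ 2 → X + κ = 0 := by
        intro X hX
        obtain ⟨z, hz1, hz2⟩ := hpt X 0
        obtain ⟨C, g, -, hz⟩ := (hmem z).2 (by
          rw [hz1, hz2]; nlinarith [mul_le_mul_of_nonneg_left hX (sq_nonneg M)])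
        have := re_conj_mul_offset α β c d C g f
        rw [← hz, hsplit, Complex.add_re, hz1, ha, hb, ← hκ, zero_mul, inner_zero_left,
          add_zero] at this
        exact this
      have hX : N ^ 2 * ‖f‖ ^ 2 ≤ 4 * (N * ‖f‖) ^ 2 := by
        rw [mul_pow]; nlinarith [mul_nonneg (sq_nonneg N) hF.le]
      have h1 := hsing _ hX
      have h2 := hsing (-(N * ‖f‖)) (by rwa [neg_sq])
      have h3 : 0 < N * ‖f‖ := mul_pos hN (by
        by_contra h0; rw [le_antisymm (not_lt.1 h0) (norm_nonneg f)] at hF; simp at hF)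
      linarith
    -- A projection onto all nonzero reals meets the omitted strip: at its midpoint, unless that
    -- midpoint is the excluded value.
    · have hall : ∀ x : ℝ, x ≠ 0 → N ^ 2 * ‖f‖ ^ 2 ≤ 4 * (x - κ) ^ 2 := fun x hx => by
        obtain ⟨C, g, hC, hx⟩ := exists_unit_lorentz_eq (sub_nonpos.1 (not_lt.1 hle)) hb hx
        exact hproj hC hx
      have hNF : 0 < N ^ 2 * ‖f‖ ^ 2 := by positivity
      by_cases h0 : κ = 0
      · have hn : 0 < N * ‖f‖ := lt_of_le_of_ne (by positivity) fun h0 => by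
          rw [← mul_pow, ← h0] at hNF; simp at hNF
        have := hall (N * ‖f‖ / 4) (by positivity)
        rw [h0] at this
        nlinarith
      · have := hall κ h0
        rw [sub_self] at this
        linarith
  -- In the direction of the other axis the projection of the disc is surjective.
  have hneg : timeCoef α β (Complex.I * f) ^ 2 - ‖spaceCoef c d (Complex.I * f)‖ ^ 2 < 0 := by
    by_contra hge
    have hsurj : ∀ Y : ℝ, ∃ (C : ℝ) (g : EuclideanSpace ℂ (Fin r)), C ^ 2 - ‖g‖ ^ 2 = 1 ∧
        timeCoef α β (Complex.I * f) * C + inner ℝ (spaceCoef c d (Complex.I * f)) g = Y := by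
      intro Y
      set Y' := Y - (conj f * (m - m')).im with hY'
      -- The abscissa is that of the point of the hyperbola with ordinate `Y'`.
      obtain ⟨z, hz1, hz2⟩ := hpt (√((N ^ 2 * M ^ 2 * ‖f‖ ^ 2 + 4 * N ^ 2 * Y' ^ 2)
        / (4 * M ^ 2))) Y'
      obtain ⟨C, g, hC, hz⟩ := (hmem z).2 (by
        rw [hz1, hz2, Real.sq_sqrt (by positivity)]
        field_simp
        linarith)
      refine ⟨C, g, hC, ?_⟩
      rw [← re_conj_mul_offset, ← hz, re_conj_mul_I, hsplit, Complex.add_im, hz2, hY']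
      ring
    -- A unit timelike vector is orthogonal to no nonzero causal one, so the covector vanishes.
    obtain ⟨C, g, hC, h0⟩ := hsurj 0
    obtain ⟨ha, hb⟩ := eq_zero_of_lorentz_orthogonal (by linarith) hC h0
    obtain ⟨C', g', -, h1⟩ := hsurj 1
    rw [ha, hb] at h1
    simp at h1
  have q₁ := hq f
  have q₂ := hq (Complex.I * f)
  set S := (α - β) ^ 2 + 4 * (c ⬝ᵥ d)
  have hI : (conj (Complex.I * f) ^ 2 * S).re = -(conj f ^ 2 * S).re := by
    rw [map_mul, mul_pow, Complex.conj_I, neg_sq, Complex.I_sq, neg_one_mul, neg_mul,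
      Complex.neg_re]
  rw [hI, norm_mul, Complex.norm_I, one_mul] at q₂
  have hre := Complex.abs_re_le_norm (conj f ^ 2 * S)
  rw [norm_mul, norm_pow, Complex.norm_conj, abs_le] at hre
  refine abs_lt.2 ⟨?_, ?_⟩
  · refine lt_of_mul_lt_mul_left ?_ hF.le
    linarith
  · refine lt_of_mul_lt_mul_left ?_ hF.le
    linarith

end KreinRange

open KreinRange in
theorem mainTheorem7 (r : ℕ) (hr : 1 ≤ r) (α β : ℂ) (c d : Fin r → ℂ)
    (s : ℂ) (hs : s ^ 2 = (α - β) ^ 2 + 4 * (c ⬝ᵥ d)) :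
    ((∃ (f₁ f₂ : ℂ) (M : ℝ),
        IsHyperbolicDisc (numericalRange (inertia r 1) (arrowhead α β c d)) f₁ f₂ M) ↔
      |‖α - β‖ ^ 2 - 2 * ‖WithLp.toLp 2 c‖ ^ 2 - 2 * ‖WithLp.toLp 2 d‖ ^ 2| <
        ‖(α - β) ^ 2 + 4 * (c ⬝ᵥ d)‖) ∧
    (IsHyperbolicDisc (numericalRange (inertia r 1) (arrowhead α β c d))
        ((α + β) / 2 + s / 2) ((α + β) / 2 - s / 2)
        (√(‖(α - β) ^ 2 + 4 * (c ⬝ᵥ d)‖ / 2 - ‖α - β‖ ^ 2 / 2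
          + ‖WithLp.toLp 2 c‖ ^ 2 + ‖WithLp.toLp 2 d‖ ^ 2)) ↔
      |‖α - β‖ ^ 2 - 2 * ‖WithLp.toLp 2 c‖ ^ 2 - 2 * ‖WithLp.toLp 2 d‖ ^ 2| <
        ‖(α - β) ^ 2 + 4 * (c ⬝ᵥ d)‖) := by
  exact ⟨⟨fun ⟨_, _, _, h⟩ => abs_lt_norm_of_isHyperbolicDisc hr α β c d h,
      fun h => ⟨_, _, _, isHyperbolicDisc_numericalRange hr α β c d s hs h⟩⟩,
    abs_lt_norm_of_isHyperbolicDisc hr α β c d, isHyperbolicDisc_numericalRange hr α β c d s hs⟩
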